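/- For integers $n,k,\ell\ge 1$ and a ground truth $Z^*\in\mathbb{R}^{n\times \ell}$ with rows $z_1^*,\dots,z_n^*$, the complete-graph sensor network localization (SNL) problem in dimension $k$ is the minimization over $Z\in\mathbb{R}^{n\times k}$, with rows $z_1,\dots,z_n$, of $$f_{Z^*}(Z)=\big\|\Delta\big(ZZ^\top-Z^*Z^{*\top}\big)\big\|_F^2=\tfrac12\sum_{1\le i<j\le n}\big(\|z_i-z_j\|^2-\|z_i^*-z_j^*\|^2\big)^2,$$ where $\Delta(Y)_{ij}=\tfrac12(Y_{ii}+Y_{jj}-2Y_{ij})$. A point $Z$ is second-order critical if $\nabla f_{Z^*}(Z)=0$ and the Hessian of $f_{Z^*}$ at $Z$ is positive semidefinite on $\mathbb{R}^{n\times k}$. There is an absolute constant $C>0$ such that the following holds for all integers $n,k,\ell\ge 1$, every symmetric positive definite $\Sigma\in\mathbb{R}^{\ell\times\ell}$ and every $m\in\mathbb{R}^\ell$. Let $z_1^*,\dots,z_n^*$ be i.i.d. Gaussian random vectors in $\mathbb{R}^\ell$ with mean $m$ and covariance matrix $\Sigma$, and let $Z^*$ be the matrix with these rows. If $$n\ge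 C\ell\qquad\text{and}\qquad k\ge C\,\frac{\operatorname{tr}\Sigma+\lambda_{\max}(\Sigma)\log n}{\lambda_{\min}(\Sigma)},$$ then with probability at least $1-\frac{C}{n^2}$ (over the draw of $Z^*$), every second-order critical point $Z\in\mathbb{R}^{n\times k}$ of $f_{Z^*}$ is a global minimizer of $f_{Z^*}$. -/

import Mathlib

open MeasureTheory ProbabilityTheory
open scoped Matrix Matrix.Norms.Frobenius

noncomputable section

namespace SNL

/-- The Euclidean distance matrix map
`Δ(Y) = (1/2) (1 diag(Y)ᵀ + diag(Y) 1ᵀ - 2 Y)`, i.e.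
`Δ(Y)ᵢⱼ = (1/2) (Yᵢᵢ + Yⱼⱼ - 2 Yᵢⱼ)`. -/
def edmMap {n : ℕ} (Y : Matrix (Fin n) (Fin n) ℝ) : Matrix (Fin n) (Fin n) ℝ :=
  Matrix.of fun i j => (1 / 2 : ℝ) * (Y i i + Y j j - 2 * Y i j)

/-- The cost function of sensor network localization on the complete graph,
`f(Z) = ‖Δ(Z Zᵀ - Z⋆ Z⋆ᵀ)‖²` with the Frobenius norm, for the ground truth configuration
`Zstar = Z⋆` (the points are the rows). It is equal to
`(1/2) ∑_{i<j} (‖zᵢ - zⱼ‖² - ‖z⋆ᵢ - z⋆ⱼ‖²)²`. -/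
def cost {n l : ℕ} (Zstar : Matrix (Fin n) (Fin l) ℝ) (k : ℕ)
    (Z : Matrix (Fin n) (Fin k) ℝ) : ℝ :=
  ‖edmMap (Z * Zᵀ - Zstar * Zstarᵀ)‖ ^ 2

/-- Second-order critical points: the derivative vanishes and the second derivative is a
positive semidefinite quadratic form. -/
def IsSecondOrderCritical {E : Type*} [NormedAddCommGroup E] [NormedSpace ℝ E]
    (f : E → ℝ) (x : E) : Prop :=
  fderiv ℝ f x = 0 ∧ ∀ v : E, 0 ≤ fderiv ℝ (fderiv ℝ f) x v v

/-- Every second-order critical point of `f` is a global minimizer. -/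
def BenignLandscape {E : Type*} [NormedAddCommGroup E] [NormedSpace ℝ E] (f : E → ℝ) : Prop :=
  ∀ x : E, IsSecondOrderCritical f x → ∀ y : E, f x ≤ f y

/-- The configuration matrix whose `i`-th row is the point `z i`. -/
def configuration {n l : ℕ} (z : Fin n → EuclideanSpace ℝ (Fin l)) :
    Matrix (Fin n) (Fin l) ℝ :=
  Matrix.of fun i j => z i j

/-- The smallest eigenvalue of a real symmetric matrix (of positive size). -/
def lambdaMin {l : ℕ} {A : Matrix (Fin l) (Fin l) ℝ} (hA : A.IsHermitian) : ℝ :=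
  ⨅ i, hA.eigenvalues i

/-- The largest eigenvalue of a real symmetric matrix (of positive size). -/
def lambdaMax {l : ℕ} {A : Matrix (Fin l) (Fin l) ℝ} (hA : A.IsHermitian) : ℝ :=
  ⨆ i, hA.eigenvalues i

end SNL

end

namespace SNL

open Finset
open scoped ENNReal NNReal

/-! ### Stationary configurations and least squares. -/

section Stationary

variable {ι F : Type*} [Fintype ι] [NormedAddCommGroup F] [InnerProductSpace ℝ F]

/-! The argument splits into a deterministic criterion and two Gaussian estimates.

Deterministic part (`stress_eq_zero_of_centered`). Centre the critical points `z i` and the targets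
`y i`, and let `R` be the matrix of half-differences of squared distances, so that the cost is `f =
∑ R²`. Let `B` bound the squared target distances and let `μ` bound the Gram operator of the centred
targets from below. Stationarity says that the weighted Laplacian of `R` annihilates `z`; a maximum
principle then gives `‖z i‖² ≤ B`. Regress each target coordinate on `z`, with residual `x a`. The
stress form does not see the part explained by `z`, so its total over the residuals is its value on
`y`, namely `-2f`. Testing the Hessian on `x a ⊗ e_b` and summing over all `k` basis vectors
multiplies this negative term by `k`, while the positive term is summed once: `k f ≤ 4 n B X` with
`X = ∑ (x a i)²`. Conversely `f` dominates `‖ZZᵀ - YYᵀ‖²`, which sees the residuals through `YYᵀ`,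
so `μ X ≤ f`. If `k μ > 4 n B`, then `f = 0`.

Probabilistic part (`measure_not_wellSpread_le`). With probability `1 - O(n⁻²)` one may take `B` of
order `tr Σ + λ_max log n`, by a chi-square tail and a union bound over points, and `μ` of order `n
λ_min`, by a smallest singular value bound. The latter rests on Laplace transforms averaged over a
ball of directions (`measure_mul_le_of_ball`) in place of a net. -/

lemma sum_mul_inner_sub_sub (R : ι → ι → ℝ) (hR : ∀ i j, R i j = R j i) (z v : ι → F) :
    ∑ i, ∑ j, R i j * inner ℝ (z i - z j) (v i - v j)
      = 2 * ∑ i, inner ℝ (∑ j, R i j • (z i - z j)) (v i) := by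
  have h1 : ∑ i, ∑ j, R i j * inner ℝ (z i - z j) (v j)
      = - ∑ i, ∑ j, R i j * inner ℝ (z i - z j) (v i) := by
    rw [sum_comm, ← sum_neg_distrib]
    refine sum_congr rfl fun i _ => ?_
    rw [← sum_neg_distrib]
    refine sum_congr rfl fun j _ => ?_
    rw [hR, ← neg_sub (z i) (z j), inner_neg_left]
    ring
  simp only [inner_sub_right _ (v _), mul_sub, sum_sub_distrib, h1, sum_inner, real_inner_smul_left]
  ring

lemma sum_smul_sub_eq_zero (R : ι → ι → ℝ) (hR : ∀ i j, R i j = R j i) (z : ι → F)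
    (h : ∀ v : ι → F, ∑ i, ∑ j, R i j * inner ℝ (z i - z j) (v i - v j) = 0) (i : ι) :
    ∑ j, R i j • (z i - z j) = 0 := by
  have h0 := h fun i => ∑ j, R i j • (z i - z j)
  rw [sum_mul_inner_sub_sub R hR] at h0
  have h1 : ∑ i, ‖∑ j, R i j • (z i - z j)‖ ^ 2 = 0 := by
    simp only [real_inner_self_eq_norm_sq] at h0
    linarith
  rw [sum_eq_zero_iff_of_nonneg fun _ _ => sq_nonneg _] at h1
  simpa using h1 i (mem_univ i)

/-- A maximum principle: at a centred stationary configuration no point is farther from the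
centroid than the largest target distance. -/
lemma norm_sq_le_of_stationary (z : ι → F) (hz : ∑ i, z i = 0) (W : ι → ι → ℝ) {B : ℝ}
    (hB0 : 0 ≤ B) (hB : ∀ i j, W i j ≤ B)
    (h : ∀ i, ∑ j, (‖z i - z j‖ ^ 2 - W i j) • (z i - z j) = 0) (i : ι) :
    ‖z i‖ ^ 2 ≤ B := by
  obtain ⟨p, -, hp⟩ := exists_max_image univ (fun i => ‖z i‖) ⟨i, mem_univ i⟩
  refine (pow_le_pow_left₀ (norm_nonneg _) (hp i (mem_univ i)) 2).trans ?_
  set c := ‖z p‖ ^ 2 with hc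
  have hc0 : 0 ≤ c := sq_nonneg _
  -- Stationarity at the farthest point is paired with that point itself. The weights `a j` are
  -- nonnegative by maximality and have mean `c` by centring.
  set a : ι → ℝ := fun j => inner ℝ (z p - z j) (z p) with ha
  have ha0 : ∀ j, 0 ≤ a j := fun j => by
    have h1 := real_inner_le_norm (z j) (z p)
    have h2 := mul_le_mul_of_nonneg_right (hp j (mem_univ j)) (norm_nonneg (z p))
    simp only [ha, inner_sub_left, real_inner_self_eq_norm_sq]
    nlinarith
  have hasum : ∑ j, a j = Fintype.card ι * c := by
    simp only [ha, ← sum_inner, sum_sub_distrib, hz, sub_zero, sum_const, card_univ,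
      ← Nat.cast_smul_eq_nsmul ℝ, real_inner_smul_left, real_inner_self_eq_norm_sq, hc]
  have h0 : ∑ j, (‖z p - z j‖ ^ 2 - W p j) * a j = 0 := by
    have := congrArg (fun x => inner ℝ x (z p)) (h p)
    simpa only [sum_inner, real_inner_smul_left, inner_zero_left] using this
  have hsq : ∀ j, a j ^ 2 ≤ ‖z p - z j‖ ^ 2 * c := fun j => by
    have := abs_real_inner_le_norm (z p - z j) (z p)
    rw [hc, ← mul_pow, ← sq_abs]
    exact pow_le_pow_left₀ (abs_nonneg _) this 2
  -- By Cauchy–Schwarz `a³ ≤ c ‖z p - z j‖² a`, and `a³` lies above its tangent at the mean value `a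
  -- = c`. Summed over `j`, this gives `n c³ ≤ n B c²`.
  have hj : ∀ j, 3 * c ^ 2 * a j - 2 * c ^ 3
      ≤ B * c * a j + c * ((‖z p - z j‖ ^ 2 - W p j) * a j) := fun j => by
    have h1 := mul_le_mul_of_nonneg_right (hsq j) (ha0 j)
    have h2 := mul_le_mul_of_nonneg_right (hB p j) (mul_nonneg hc0 (ha0 j))
    have h3 : 0 ≤ (a j - c) ^ 2 * (a j + 2 * c) :=
      mul_nonneg (sq_nonneg _) (by linarith [ha0 j])
    nlinarith
  have hs := sum_le_sum fun j (_ : j ∈ univ) => hj j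
  rw [sum_sub_distrib, sum_add_distrib, ← mul_sum, ← mul_sum, ← mul_sum, ← mul_sum, h0, hasum,
    sum_const, card_univ, nsmul_eq_mul] at hs
  have hn : (0 : ℝ) < Fintype.card ι := by
    exact_mod_cast Fintype.card_pos_iff.2 ⟨i⟩
  by_contra! hlt
  have hcpos : 0 < c := hB0.trans_lt hlt
  have : Fintype.card ι * c ^ 2 * (c - B) ≤ 0 := by nlinarith
  have h4 : 0 < Fintype.card ι * c ^ 2 * (c - B) :=
    mul_pos (by positivity) (by linarith)
  linarith

/-- Least squares: `x` is approximated by the linear functional `u` of the points `z i` with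
residual orthogonal to all such functionals. -/
lemma exists_least_squares [FiniteDimensional ℝ F] (z : ι → F) (x : ι → ℝ) :
    ∃ u : F, ∀ w : F, ∑ i, (x i - inner ℝ (z i) u) * inner ℝ (z i) w = 0 := by
  let T : F →ₗ[ℝ] EuclideanSpace ℝ ι :=
    { toFun := fun w => WithLp.toLp 2 fun i => inner ℝ (z i) w
      map_add' := fun a b => by ext i; simp [inner_add_right]
      map_smul' := fun a b => by ext i; simp [inner_smul_right] }
  let y : EuclideanSpace ℝ ι := WithLp.toLp 2 x
  obtain ⟨u, hu⟩ := (LinearMap.range T).starProjection_apply_mem y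
  refine ⟨u, fun w => ?_⟩
  have h := (LinearMap.range T).starProjection_inner_eq_zero y (T w) ⟨w, rfl⟩
  rw [← hu] at h
  simpa [PiLp.inner_apply, T, y, mul_comm] using h

lemma sum_sum_sub_sq_le (x : ι → ℝ) :
    ∑ i, ∑ j, (x i - x j) ^ 2 ≤ 2 * Fintype.card ι * ∑ i, x i ^ 2 := by
  have : ∑ i, ∑ j, (x i - x j) ^ 2
      = 2 * Fintype.card ι * ∑ i, x i ^ 2 - 2 * (∑ i, x i) ^ 2 := by
    simp only [sub_sq, sum_add_distrib, sum_sub_distrib, sum_const, card_univ, nsmul_eq_mul,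
      ← mul_sum, ← sum_mul, mul_assoc]
    ring
  nlinarith [sq_nonneg (∑ i, x i)]

/-- The Euclidean distance matrix map does not decrease the Frobenius norm of a matrix with
vanishing row and column sums. -/
lemma sum_sq_le_sum_edm_sq (M : ι → ι → ℝ) (h1 : ∀ i, ∑ j, M i j = 0) (h2 : ∀ j, ∑ i, M i j = 0) :
    ∑ i, ∑ j, M i j ^ 2 ≤ ∑ i, ∑ j, ((M i i + M j j) / 2 - M i j) ^ 2 := by
  have : ∑ i, ∑ j, ((M i i + M j j) / 2 - M i j) ^ 2
      = ∑ i, ∑ j, ((M i i + M j j) / 2) ^ 2 + ∑ i, ∑ j, M i j ^ 2 := by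
    -- Each diagonal factor in the cross terms depends on one index only, so these terms reduce to
    -- row or column sums.
    have e : ∀ i j, ((M i i + M j j) / 2 - M i j) ^ 2
      = ((M i i + M j j) / 2) ^ 2 + M i j ^ 2 - M i i * M i j - M j j * M i j := by
      intros; ring
    have e2 : ∑ i, ∑ j, M j j * M i j = 0 := by
      rw [sum_comm]; simp [← mul_sum, h2]
    simp only [e, sum_sub_distrib, sum_add_distrib, e2, ← mul_sum, h1, mul_zero, sum_const_zero]
    ring
  rw [this]
  have : 0 ≤ ∑ i, ∑ j, ((M i i + M j j) / 2) ^ 2 :=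
    sum_nonneg fun _ _ => sum_nonneg fun _ _ => sq_nonneg _
  linarith

end Stationary

/-! ### The deterministic criterion for centred configurations. -/

section Landscape

variable {n k l : ℕ}

/-- Second-order criticality bounds the cost above by the regression residuals of `y` on `z`, and
the Gram matrix discrepancy bounds it below; `hk` makes the two incompatible unless the cost
vanishes. -/
lemma stress_eq_zero_of_centered (z : Fin n → EuclideanSpace ℝ (Fin k))
    (y : Fin n → EuclideanSpace ℝ (Fin l)) (hz : ∑ i, z i = 0) (hy : ∑ i, y i = 0) {B μ : ℝ}
    (hB0 : 0 ≤ B) (hμ0 : 0 < μ) (hB : ∀ i j, ‖y i - y j‖ ^ 2 ≤ B)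
    (hμ : ∀ v, μ * ‖v‖ ^ 2 ≤ ∑ i, inner ℝ (y i) v ^ 2) (hk : 4 * n * B < k * μ)
    (R : Fin n → Fin n → ℝ) (hRdef : ∀ i j, R i j = (‖z i - z j‖ ^ 2 - ‖y i - y j‖ ^ 2) / 2)
    (hst : ∀ v : Fin n → EuclideanSpace ℝ (Fin k),
      ∑ i, ∑ j, R i j * inner ℝ (z i - z j) (v i - v j) = 0)
    (hnd : ∀ v : Fin n → EuclideanSpace ℝ (Fin k),
      0 ≤ ∑ i, ∑ j, (inner ℝ (z i - z j) (v i - v j) ^ 2 + R i j * ‖v i - v j‖ ^ 2)) :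
    ∑ i, ∑ j, R i j ^ 2 = 0 := by
  set f := ∑ i, ∑ j, R i j ^ 2 with hf
  have hRsymm : ∀ i j, R i j = R j i := fun i j => by
    rw [hRdef, hRdef, norm_sub_rev, norm_sub_rev (y i)]
  have hf0 : 0 ≤ f := sum_nonneg fun _ _ => sum_nonneg fun _ _ => sq_nonneg _
  have hrow : ∀ i, ‖z i‖ ^ 2 ≤ B := by
    refine norm_sq_le_of_stationary z hz (fun i j => ‖y i - y j‖ ^ 2) hB0 hB fun i => ?_
    have := sum_smul_sub_eq_zero R hRsymm z hst i
    have h2 : (2 : ℝ) • ∑ j, R i j • (z i - z j) = 0 := by rw [this, smul_zero]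
    rw [smul_sum] at h2
    rw [← h2]
    refine sum_congr rfl fun j _ => ?_
    rw [smul_smul, hRdef]
    congr 1; ring
  have hD : ∀ i j, ‖z i - z j‖ ^ 2 ≤ 4 * B := fun i j => by
    have h1 := norm_sub_le (z i) (z j)
    have h2 := pow_le_pow_left₀ (norm_nonneg _) h1 2
    nlinarith [hrow i, hrow j, sq_nonneg (‖z i‖ - ‖z j‖)]
  choose u hu using fun a : Fin l => exists_least_squares z fun i => y i a
  set x : Fin l → Fin n → ℝ := fun a i => y i a - inner ℝ (z i) (u a) with hx
  -- the stress form at the residual directions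
  have hRR : ∑ i, ∑ j, R i j * ‖z i - z j‖ ^ 2 = 0 := by
    simpa only [real_inner_self_eq_norm_sq] using hst z
  have hRy : ∑ i, ∑ j, R i j * ‖y i - y j‖ ^ 2 = - 2 * f := by
    have : ∑ i, ∑ j, R i j * ‖y i - y j‖ ^ 2
        = ∑ i, ∑ j, R i j * ‖z i - z j‖ ^ 2 - 2 * f := by
      simp only [hf, mul_sum, ← sum_sub_distrib]
      refine sum_congr rfl fun i _ => sum_congr rfl fun j _ => ?_
      rw [hRdef]; ring
    rw [this, hRR]; ring
  have hRx : ∑ a, ∑ i, ∑ j, R i j * (x a i - x a j) ^ 2 = - 2 * f := by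
    -- The residual differs from the coordinate of `y` by a linear functional of `z`; stationarity
    -- tested along `u a` removes every term containing that functional.
    have h1 : ∀ a, ∑ i, ∑ j, R i j * (x a i - x a j) ^ 2
        = ∑ i, ∑ j, R i j * (y i a - y j a) ^ 2 := fun a => by
      have e1 := hst fun i => y i a • u a
      have e2 := hst fun i => inner ℝ (z i) (u a) • u a
      have e3 : ∀ i j, R i j * (x a i - x a j) ^ 2 = R i j * (y i a - y j a) ^ 2
          - 2 * (R i j * inner ℝ (z i - z j) (y i a • u a - y j a • u a))
          + R i j * inner ℝ (z i - z j) (inner ℝ (z i) (u a) • u a - inner ℝ (z j) (u a) • u a) := by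
        intro i j
        rw [← sub_smul, ← sub_smul, real_inner_smul_right, real_inner_smul_right, inner_sub_left]
        simp only [hx]; ring
      simp only [e3, sum_add_distrib, sum_sub_distrib, ← mul_sum, e1, e2]
      ring
    simp only [h1]
    rw [sum_comm, ← hRy]
    refine sum_congr rfl fun i _ => ?_
    rw [sum_comm]
    refine sum_congr rfl fun j _ => ?_
    rw [← mul_sum, EuclideanSpace.real_norm_sq_eq]
    rfl
  have hsecond : ∀ a, 0 ≤ ∑ i, ∑ j, ‖z i - z j‖ ^ 2 * (x a i - x a j) ^ 2
      + k * ∑ i, ∑ j, R i j * (x a i - x a j) ^ 2 := fun a => by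
    -- Summing over the basis recombines the first Hessian term into `‖z i - z j‖²` and repeats the
    -- stress term `k` times.
    have h1 := sum_nonneg fun b (_ : b ∈ (univ : Finset (Fin k))) =>
      hnd fun i => x a i • EuclideanSpace.single b (1 : ℝ)
    rw [sum_comm] at h1
    refine h1.trans_eq ?_
    rw [mul_sum, ← sum_add_distrib]
    refine sum_congr rfl fun i _ => ?_
    rw [sum_comm, mul_sum, ← sum_add_distrib]
    refine sum_congr rfl fun j _ => ?_
    simp only [← sub_smul, real_inner_smul_right, norm_smul, EuclideanSpace.inner_single_right,
      PiLp.norm_single, norm_one, mul_one, Real.norm_eq_abs, sq_abs, sum_add_distrib,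
      sum_const, card_univ, Fintype.card_fin, nsmul_eq_mul]
    simp only [EuclideanSpace.real_norm_sq_eq, sum_mul]
    congr 1
    refine sum_congr rfl fun b _ => ?_
    simp [mul_pow, mul_comm]
  set X := ∑ a, ∑ i, x a i ^ 2 with hX
  have hkf : k * f ≤ 4 * n * B * X := by
    have h1 : ∀ a, ∑ i, ∑ j, ‖z i - z j‖ ^ 2 * (x a i - x a j) ^ 2
        ≤ 4 * B * (2 * n * ∑ i, x a i ^ 2) := fun a => by
      have := sum_sum_sub_sq_le (x a)
      rw [Fintype.card_fin] at this
      refine le_trans ?_ (mul_le_mul_of_nonneg_left this (by linarith))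
      simp only [mul_sum]
      exact sum_le_sum fun i _ => sum_le_sum fun j _ =>
        mul_le_mul_of_nonneg_right (hD i j) (sq_nonneg _)
    have h2 := sum_nonneg fun a (_ : a ∈ (univ : Finset (Fin l))) =>
      (hsecond a).trans (add_le_add_left (h1 a) _)
    rw [sum_add_distrib, ← mul_sum, ← mul_sum, ← mul_sum, hRx] at h2
    linarith
  -- the lower bound for the cost
  have hfX : μ * X ≤ f := by
    set M : Fin n → Fin n → ℝ := fun i j => inner ℝ (z i) (z j) - inner ℝ (y i) (y j) with hM
    have hMf : ∑ i, ∑ j, M i j ^ 2 ≤ f := by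
      refine (sum_sq_le_sum_edm_sq M (fun i => ?_) fun j => ?_).trans_eq ?_
      · simp [hM, sum_sub_distrib, ← inner_sum, hz, hy]
      · simp [hM, sum_sub_distrib, ← sum_inner, hz, hy]
      · refine sum_congr rfl fun i _ => sum_congr rfl fun j _ => ?_
        rw [hRdef, @norm_sub_sq_real _ _ _ (z i), @norm_sub_sq_real _ _ _ (y i)]
        simp only [hM, real_inner_self_eq_norm_sq]
        congr 1; ring
    set e : Fin n → EuclideanSpace ℝ (Fin l) := fun i => WithLp.toLp 2 fun a => x a i with he
    -- With `P` the projection off the column space of `Z`, `E = PY` and `EYᵀ = P(YYᵀ)`. Hence `EYᵀ`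
    -- is orthogonal to `ZZᵀ`, and its product with `YYᵀ` is `‖EYᵀ‖²`.
    have hW : ∑ i, ∑ j, inner ℝ (y j) (e i) ^ 2 = - ∑ i, ∑ j, M i j * inner ℝ (y j) (e i) := by
      have hin : ∀ i j, inner ℝ (y j) (e i) = ∑ a, x a i * y j a := fun i j => by
        simp [PiLp.inner_apply, he]
      have hcol : ∀ a (w : EuclideanSpace ℝ (Fin k)), ∑ i, x a i * inner ℝ (z i) w = 0 :=
        fun a w => hu a w
      have h1 : ∀ j, ∑ i, inner ℝ (z i) (z j) * inner ℝ (y j) (e i) = 0 := fun j => by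
        simp only [hin, mul_sum]
        rw [sum_comm]
        refine sum_eq_zero fun a _ => ?_
        have := congrArg (fun t => y j a * t) (hcol a (z j))
        rw [mul_zero, mul_sum] at this
        rw [← this]
        exact sum_congr rfl fun i _ => by ring
      have h2 : ∀ j, ∑ i, inner ℝ (y i) (y j) * inner ℝ (y j) (e i)
          = ∑ i, inner ℝ (y j) (e i) ^ 2 := fun j => by
        rw [← sub_eq_zero, ← sum_sub_distrib]
        set w := ∑ b, y j b • u b with hw
        have h3 : ∀ i, inner ℝ (y i) (y j) - inner ℝ (y j) (e i) = inner ℝ (z i) w := fun i => by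
          rw [hin, PiLp.inner_apply, hw, inner_sum, ← sum_sub_distrib]
          refine sum_congr rfl fun b _ => ?_
          simp only [hx, real_inner_smul_right, RCLike.inner_apply, conj_trivial]
          ring
        have h4 : ∑ i, inner ℝ (z i) w * inner ℝ (y j) (e i) = 0 := by
          simp only [hin, mul_sum]
          rw [sum_comm]
          refine sum_eq_zero fun a _ => ?_
          have := congrArg (fun t => y j a * t) (hcol a w)
          rw [mul_zero, mul_sum] at this
          rw [← this]
          exact sum_congr rfl fun i _ => by ring
        rw [← h4]
        refine sum_congr rfl fun i _ => ?_
        rw [← h3]; ring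
      rw [sum_comm, eq_neg_iff_add_eq_zero, sum_comm (f := fun i j => M i j * inner ℝ (y j) (e i)),
        ← sum_add_distrib, sum_eq_zero]
      intro j _
      have := h1 j
      have := h2 j
      simp only [hM, sub_mul, sum_sub_distrib]
      linarith
    have hWM : ∑ i, ∑ j, inner ℝ (y j) (e i) ^ 2 ≤ ∑ i, ∑ j, M i j ^ 2 := by
      have : ∑ i, ∑ j, (-(M i j * inner ℝ (y j) (e i)))
          ≤ ∑ i, ∑ j, (M i j ^ 2 / 2 + inner ℝ (y j) (e i) ^ 2 / 2) :=
        sum_le_sum fun i _ => sum_le_sum fun j _ => by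
          nlinarith [sq_nonneg (M i j + inner ℝ (y j) (e i))]
      simp only [sum_neg_distrib, sum_add_distrib, ← sum_div] at this
      rw [← hW] at this
      linarith
    have hXe : X = ∑ i, ‖e i‖ ^ 2 := by
      rw [hX, sum_comm]
      exact sum_congr rfl fun i _ => by rw [EuclideanSpace.real_norm_sq_eq]
    calc μ * X = ∑ i, μ * ‖e i‖ ^ 2 := by rw [hXe, mul_sum]
      _ ≤ ∑ i, ∑ j, inner ℝ (y j) (e i) ^ 2 := sum_le_sum fun i _ => hμ (e i)
      _ ≤ f := hWM.trans hMf
  by_contra hne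
  have hfpos : 0 < f := lt_of_le_of_ne hf0 (Ne.symm hne)
  have h1 : k * μ * f ≤ 4 * n * B * f := by
    have := mul_le_mul_of_nonneg_left hfX (show 0 ≤ 4 * n * B by positivity)
    nlinarith [mul_le_mul_of_nonneg_right hkf hμ0.le]
  have := mul_lt_mul_of_pos_right hk hfpos
  linarith

end Landscape

/-! ### From derivatives of the cost to conditions on the points. -/

/-- The cost restricted to any line is a quartic polynomial, so both derivatives can be read off
from its coefficients. -/
lemma fderiv_eq_of_quartic {E : Type*} [NormedAddCommGroup E] [NormedSpace ℝ E] {f : E → ℝ}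
    (hf : ContDiff ℝ 2 f) {x v : E} {c₀ c₁ c₂ c₃ c₄ : ℝ}
    (h : ∀ t : ℝ, f (x + t • v) = c₀ + c₁ * t + c₂ * t ^ 2 + c₃ * t ^ 3 + c₄ * t ^ 4) :
    fderiv ℝ f x v = c₁ ∧ fderiv ℝ (fderiv ℝ f) x v v = 2 * c₂ := by
  have hline : ∀ t : ℝ, HasDerivAt (fun t : ℝ => x + t • v) v t := fun t => by
    simpa using ((hasDerivAt_id t).smul_const v).const_add x
  have h1 : ∀ t : ℝ, HasDerivAt (fun t : ℝ => f (x + t • v)) (fderiv ℝ f (x + t • v) v) t :=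
    fun t => ((hf.differentiable (by norm_num)) _).hasFDerivAt.comp_hasDerivAt t (hline t)
  have hpoly : ∀ t : ℝ, fderiv ℝ f (x + t • v) v
      = c₁ + 2 * c₂ * t + 3 * c₃ * t ^ 2 + 4 * c₄ * t ^ 3 := fun t => by
    refine (h1 t).unique ?_
    simp only [h]
    have := ((((hasDerivAt_const t c₀).add ((hasDerivAt_id t).const_mul c₁)).add
      ((hasDerivAt_pow 2 t).const_mul c₂)).add ((hasDerivAt_pow 3 t).const_mul c₃)).add
      ((hasDerivAt_pow 4 t).const_mul c₄)
    refine this.congr_deriv ?_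
    norm_num
    ring
  refine ⟨by simpa using hpoly 0, ?_⟩
  have hf' : ContDiff ℝ 1 (fderiv ℝ f) := hf.fderiv_right (by norm_num)
  have h2 : HasDerivAt (fun t : ℝ => fderiv ℝ f (x + t • v) v)
      (fderiv ℝ (fderiv ℝ f) (x + (0 : ℝ) • v) v v) 0 := by
    have := ((hf'.differentiable (by norm_num)) (x + (0 : ℝ) • v)).hasFDerivAt.comp_hasDerivAt 0
      (hline 0)
    exact (ContinuousLinearMap.apply ℝ ℝ v).hasFDerivAt.comp_hasDerivAt 0 this
  rw [zero_smul, add_zero] at h2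
  refine h2.unique ?_
  simp only [hpoly]
  have := (((hasDerivAt_const (0 : ℝ) c₁).add ((hasDerivAt_id (0 : ℝ)).const_mul (2 * c₂))).add
    ((hasDerivAt_pow 2 (0 : ℝ)).const_mul (3 * c₃))).add
    ((hasDerivAt_pow 3 (0 : ℝ)).const_mul (4 * c₄))
  refine this.congr_deriv ?_
  norm_num

section Cost

variable {n k l : ℕ}

/-- The `i`-th point of the configuration matrix `Z`. -/
def point (Z : Matrix (Fin n) (Fin k) ℝ) (i : Fin n) : EuclideanSpace ℝ (Fin k) :=
  WithLp.toLp 2 (Z i)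

lemma cost_configuration (y : Fin n → EuclideanSpace ℝ (Fin l)) (Z : Matrix (Fin n) (Fin k) ℝ) :
    cost (configuration y) k Z
      = ∑ i, ∑ j, ((‖point Z i - point Z j‖ ^ 2 - ‖y i - y j‖ ^ 2) / 2) ^ 2 := by
  have h : ∀ A : Matrix (Fin n) (Fin n) ℝ, ‖A‖ ^ 2 = ∑ i, ∑ j, A i j ^ 2 := fun A => by
    rw [Matrix.frobenius_norm_def, ← Real.sqrt_eq_rpow, Real.sq_sqrt]
    · simp
    · exact sum_nonneg fun _ _ => sum_nonneg fun _ _ => by positivity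
  rw [cost, h]
  refine sum_congr rfl fun i _ => sum_congr rfl fun j _ => ?_
  congr 1
  simp only [edmMap, Matrix.of_apply, Matrix.sub_apply, Matrix.mul_apply, Matrix.transpose_apply,
    EuclideanSpace.real_norm_sq_eq, PiLp.sub_apply, point, configuration, sub_sq, sum_add_distrib,
    sum_sub_distrib, mul_assoc, ← mul_sum, ← pow_two]
  ring

lemma contDiff_cost (Y : Matrix (Fin n) (Fin l) ℝ) : ContDiff ℝ 2 (cost Y k) := by
  have he : ∀ i a, ContDiff ℝ 2 fun Z : Matrix (Fin n) (Fin k) ℝ => Z i a := fun i a =>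
    (Matrix.entryLinearMap ℝ ℝ i a).toContinuousLinearMap.contDiff
  have h : cost Y k = fun Z => ∑ i, ∑ j, (edmMap (Z * Zᵀ - Y * Yᵀ) i j) ^ 2 := by
    funext Z
    rw [cost, Matrix.frobenius_norm_def, ← Real.sqrt_eq_rpow, Real.sq_sqrt]
    · simp
    · exact sum_nonneg fun _ _ => sum_nonneg fun _ _ => by positivity
  rw [h]
  simp only [edmMap, Matrix.of_apply, Matrix.sub_apply, Matrix.mul_apply, Matrix.transpose_apply]
  have hs : ∀ i j, ContDiff ℝ 2 fun Z : Matrix (Fin n) (Fin k) ℝ => ∑ a, Z i a * Z j a :=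
    fun i j => ContDiff.sum fun a _ => (he i a).mul (he j a)
  have hs' : ∀ i j (c : ℝ), ContDiff ℝ 2
      fun Z : Matrix (Fin n) (Fin k) ℝ => ∑ a, Z i a * Z j a - c :=
    fun i j c => (hs i j).sub contDiff_const
  exact ContDiff.sum fun i _ => ContDiff.sum fun j _ => (contDiff_const.mul
    (((hs' i i _).add (hs' j j _)).sub (contDiff_const.mul (hs' i j _)))).pow 2

/-- First and second order criticality in terms of the points. -/
lemma IsSecondOrderCritical.stationary_and_nonneg {y : Fin n → EuclideanSpace ℝ (Fin l)}
    {Z : Matrix (Fin n) (Fin k) ℝ} (hZ : IsSecondOrderCritical (cost (configuration y) k) Z)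
    (v : Fin n → EuclideanSpace ℝ (Fin k)) :
    ∑ i, ∑ j, (‖point Z i - point Z j‖ ^ 2 - ‖y i - y j‖ ^ 2) / 2
        * inner ℝ (point Z i - point Z j) (v i - v j) = 0 ∧
      0 ≤ ∑ i, ∑ j, (inner ℝ (point Z i - point Z j) (v i - v j) ^ 2
        + (‖point Z i - point Z j‖ ^ 2 - ‖y i - y j‖ ^ 2) / 2 * ‖v i - v j‖ ^ 2) := by
  set V : Matrix (Fin n) (Fin k) ℝ := Matrix.of fun i a => v i a
  set R : Fin n → Fin n → ℝ := fun i j =>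
    (‖point Z i - point Z j‖ ^ 2 - ‖y i - y j‖ ^ 2) / 2 with hR
  set b : Fin n → Fin n → ℝ := fun i j => inner ℝ (point Z i - point Z j) (v i - v j) with hb
  set q : Fin n → Fin n → ℝ := fun i j => ‖v i - v j‖ ^ 2 with hq
  have hp : ∀ (t : ℝ) i, point (Z + t • V) i = point Z i + t • v i := fun t i => by
    ext a; simp [point, V]
  have hline : ∀ t : ℝ, cost (configuration y) k (Z + t • V)
      = ∑ i, ∑ j, R i j ^ 2 + (2 * ∑ i, ∑ j, R i j * b i j) * t
        + (∑ i, ∑ j, (b i j ^ 2 + R i j * q i j)) * t ^ 2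
        + (∑ i, ∑ j, b i j * q i j) * t ^ 3 + (∑ i, ∑ j, q i j ^ 2 / 4) * t ^ 4 := fun t => by
    rw [cost_configuration]
    simp only [mul_sum, sum_mul, ← sum_add_distrib]
    refine sum_congr rfl fun i _ => sum_congr rfl fun j _ => ?_
    have : point (Z + t • V) i - point (Z + t • V) j
        = (point Z i - point Z j) + t • (v i - v j) := by
      rw [hp, hp, smul_sub]; abel
    rw [this, norm_add_sq_real, real_inner_smul_right, norm_smul, mul_pow, Real.norm_eq_abs, sq_abs]
    simp only [hR, hb, hq]
    ring
  obtain ⟨h1, h2⟩ := fderiv_eq_of_quartic (contDiff_cost _) hline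
  have h3 := hZ.2 V
  rw [h2] at h3
  rw [hZ.1] at h1
  simp only [_root_.zero_apply] at h1
  exact ⟨by linarith, by linarith⟩

/-- A deterministic condition for a benign landscape: the relaxed dimension exceeds four times the
ratio of the largest squared distance to the smallest variance of the ground truth. -/
theorem benignLandscape_of_bounds (y : Fin n → EuclideanSpace ℝ (Fin l)) {B μ : ℝ}
    (hB0 : 0 ≤ B) (hμ0 : 0 < μ) (hB : ∀ i j, ‖y i - y j‖ ^ 2 ≤ B)
    (hμ : ∀ v (c : ℝ), μ * ‖v‖ ^ 2 ≤ ∑ i, (inner ℝ (y i) v - c) ^ 2) (hk : 4 * n * B < k * μ) :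
    BenignLandscape (cost (configuration y) k) := by
  intro Z hZ Z'
  have hnonneg : 0 ≤ cost (configuration y) k Z' := sq_nonneg _
  refine le_trans (le_of_eq ?_) hnonneg
  rw [cost_configuration]
  rcases Nat.eq_zero_or_pos n with rfl | hn
  · simp
  have hn' : (n : ℝ) ≠ 0 := by positivity
  -- Only differences of points enter the cost, so both configurations may be centred; the free
  -- offset `c` in `hμ` absorbs the mean of `y`.
  have hcen : ∀ {d : ℕ} (w : Fin n → EuclideanSpace ℝ (Fin d)),
      ∑ i, (w i - (n : ℝ)⁻¹ • ∑ j, w j) = 0 := fun w => by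
    rw [sum_sub_distrib, sum_const, card_univ, Fintype.card_fin, ← Nat.cast_smul_eq_nsmul ℝ,
      smul_smul, mul_inv_cancel₀ hn', one_smul, sub_self]
  refine stress_eq_zero_of_centered (fun i => point Z i - (n : ℝ)⁻¹ • ∑ j, point Z j)
    (fun i => y i - (n : ℝ)⁻¹ • ∑ j, y j) (hcen _) (hcen _) hB0 hμ0 ?_ ?_ hk _ ?_ ?_ ?_
  · simpa using hB
  · intro v
    simpa only [inner_sub_left] using hμ v _
  · simp
  · intro v
    simpa using (hZ.stationary_and_nonneg v).1
  · intro v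
    simpa using (hZ.stationary_and_nonneg v).2

end Cost

/-! ### Laplace transforms of Gaussian quadratic forms. -/

section GaussianMoments

/-- The Laplace transform of the square of a shifted one-dimensional Gaussian. -/
lemma lintegral_exp_neg_mul_sq_gaussianReal_le (v : ℝ≥0) {s a : ℝ} (hs : 0 < 1 + 2 * s * v)
    (ha : 0 ≤ s * a ^ 2) :
    ∫⁻ x, ENNReal.ofReal (Real.exp (-s * (x - a) ^ 2)) ∂gaussianReal 0 v
      ≤ ENNReal.ofReal (√(1 + 2 * s * v))⁻¹ := by
  rcases eq_or_ne v 0 with rfl | hv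
  · simp only [gaussianReal_zero_var, lintegral_dirac]
    refine ENNReal.ofReal_le_ofReal ?_
    simpa using ha
  have hv0 : (0 : ℝ) < v := by exact_mod_cast pos_iff_ne_zero.2 hv
  -- Completing the square gives a Gaussian weight with coefficient `b`. The leftover constant is
  -- nonpositive by `ha`, which permits either every shift with `s ≥ 0` or `a = 0` with `s < 0`.
  set b : ℝ := s + 1 / (2 * v) with hb
  have hb0 : 0 < b := by
    have : b = (1 + 2 * s * v) / (2 * v) := by rw [hb]; field_simp; ring
    rw [this]; positivity
  have hpt : ∀ x : ℝ, gaussianPDF 0 v x * ENNReal.ofReal (Real.exp (-s * (x - a) ^ 2))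
      ≤ ENNReal.ofReal ((√(2 * Real.pi * v))⁻¹ * Real.exp (-b * (x - s * a / b) ^ 2)) := by
    intro x
    rw [gaussianPDF, ← ENNReal.ofReal_mul (gaussianPDFReal_nonneg _ _ _), gaussianPDFReal,
      mul_assoc, ← Real.exp_add]
    refine ENNReal.ofReal_le_ofReal
      (mul_le_mul_of_nonneg_left (Real.exp_le_exp.2 ?_) (by positivity))
    have : -(x - 0) ^ 2 / (2 * v) + -s * (x - a) ^ 2
        = -b * (x - s * a / b) ^ 2 - s * a ^ 2 * (1 / (2 * v)) / b := by
      have h2 : b * (s * a / b) = s * a := by field_simp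
      have h3 : s * a ^ 2 * (1 / (2 * v)) / b + b * (s * a / b) ^ 2 = s * a ^ 2 := by
        have : 1 / (2 * (v : ℝ)) = b - s := by rw [hb]; ring
        rw [this]; field_simp; ring
      have h4 : -(x - 0) ^ 2 / (2 * (v : ℝ)) = - (1 / (2 * v)) * x ^ 2 := by ring
      rw [h4]
      have h5 : 1 / (2 * (v : ℝ)) = b - s := by rw [hb]; ring
      rw [h5] at h3 ⊢
      linear_combination h3 - 2 * x * h2
    rw [this]
    have : 0 ≤ s * a ^ 2 * (1 / (2 * v)) / b := by positivity
    linarith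
  rw [gaussianReal_of_var_ne_zero _ hv,
    lintegral_withDensity_eq_lintegral_mul _ (measurable_gaussianPDF _ _) (by fun_prop)]
  refine (lintegral_mono hpt).trans (le_of_eq ?_)
  have hint : Integrable fun x : ℝ => Real.exp (-b * (x - s * a / b) ^ 2) :=
    (integrable_exp_neg_mul_sq hb0).comp_sub_right _
  rw [← ofReal_integral_eq_lintegral_ofReal (hint.const_mul _)
    (Filter.Eventually.of_forall fun x => by positivity), integral_const_mul,
    integral_sub_right_eq_self (fun x : ℝ => Real.exp (-b * x ^ 2)) (s * a / b), integral_gaussian,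
    ← Real.sqrt_inv, ← Real.sqrt_inv, ← Real.sqrt_mul (by positivity)]
  congr 2
  rw [hb]
  have : s + 1 / (2 * (v : ℝ)) = (1 + 2 * s * v) / (2 * v) := by field_simp; ring
  rw [this]
  field_simp

variable {d n : ℕ}

lemma map_inner_stdGaussian (w : EuclideanSpace ℝ (Fin d)) :
    (stdGaussian (EuclideanSpace ℝ (Fin d))).map (fun x => inner ℝ x w)
      = gaussianReal 0 (‖w‖₊ ^ 2) := by
  have h := IsGaussian.map_eq_gaussianReal (μ := stdGaussian (EuclideanSpace ℝ (Fin d)))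
    (innerSL ℝ w)
  rw [integral_strongDual_stdGaussian, variance_dual_stdGaussian, innerSL_apply_norm] at h
  have e : (fun x => inner ℝ x w) = ⇑(innerSL ℝ w) := by
    funext x; rw [innerSL_apply_apply, real_inner_comm]
  rw [e, h]
  congr 1
  rw [Real.toNNReal_pow (norm_nonneg _), norm_toNNReal]

/-- The standard Gaussian measure for `n` independent points. -/
noncomputable abbrev gaussianPoints (n d : ℕ) : Measure (Fin n → EuclideanSpace ℝ (Fin d)) :=
  Measure.pi fun _ => stdGaussian (EuclideanSpace ℝ (Fin d))

lemma lintegral_prod_pi {ι : Type*} [Fintype ι] {X : ι → Type*} [∀ i, MeasurableSpace (X i)]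
    (μ : ∀ i, Measure (X i)) [∀ i, IsProbabilityMeasure (μ i)] (f : ∀ i, X i → ℝ≥0∞)
    (hf : ∀ i, Measurable (f i)) :
    ∫⁻ x, ∏ i, f i (x i) ∂Measure.pi μ = ∏ i, ∫⁻ y, f i y ∂μ i := by
  rw [lintegral_prod_eq_prod_lintegral_of_indepFun univ (fun i (x : ∀ i, X i) => f i (x i))
    (iIndepFun_pi fun i => (hf i).aemeasurable) fun i => (hf i).comp (measurable_pi_apply i)]
  refine prod_congr rfl fun i _ => ?_
  rw [← (measurePreserving_eval μ i).lintegral_comp (hf i)]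

/-- Independence factorises the exponential over the points. Negative `s` serves the upper tail,
positive `s` the small-ball estimate. -/
lemma lintegral_exp_sum_sq_le (w : EuclideanSpace ℝ (Fin d)) {s a : ℝ}
    (hs : 0 < 1 + 2 * s * ‖w‖ ^ 2) (ha : 0 ≤ s * a ^ 2) :
    ∫⁻ g, ENNReal.ofReal (Real.exp (-s * ∑ i, (inner ℝ (g i) w - a) ^ 2)) ∂gaussianPoints n d
      ≤ ENNReal.ofReal (√(1 + 2 * s * ‖w‖ ^ 2))⁻¹ ^ n := by
  have h : ∀ g : Fin n → EuclideanSpace ℝ (Fin d),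
      ENNReal.ofReal (Real.exp (-s * ∑ i, (inner ℝ (g i) w - a) ^ 2))
        = ∏ i, ENNReal.ofReal (Real.exp (-s * (inner ℝ (g i) w - a) ^ 2)) := fun g => by
    rw [mul_sum, Real.exp_sum, ENNReal.ofReal_prod_of_nonneg fun _ _ => (Real.exp_pos _).le]
  simp only [h]
  rw [lintegral_prod_pi _ (fun _ x => ENNReal.ofReal (Real.exp (-s * (inner ℝ x w - a) ^ 2)))
    (by fun_prop), prod_const, card_univ, Fintype.card_fin]
  refine pow_le_pow_left' ?_ n
  have hm : Measurable fun x : EuclideanSpace ℝ (Fin d) => (inner ℝ x w : ℝ) := by fun_prop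
  have := lintegral_exp_neg_mul_sq_gaussianReal_le (‖w‖₊ ^ 2) (s := s) (a := a)
    (by simpa using hs) ha
  rw [← map_inner_stdGaussian, lintegral_map (by fun_prop) hm] at this
  simpa using this

lemma inv_sqrt_one_sub_le_exp {u : ℝ} (h0 : 0 ≤ u) (h1 : u ≤ 1 / 2) :
    (√(1 - u))⁻¹ ≤ Real.exp u := by
  rw [← Real.sqrt_inv, Real.sqrt_le_left (Real.exp_pos _).le, ← Real.exp_nat_mul]
  have h2 : 1 + 2 * u ≤ Real.exp ((2 : ℕ) * u) := by
    have := Real.add_one_le_exp (2 * u)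
    push_cast; linarith
  refine le_trans ?_ h2
  rw [inv_le_iff_one_le_mul₀ (by linarith)]
  nlinarith

/-- The exponential moment of a positive quadratic form of a standard Gaussian vector. -/
lemma lintegral_exp_quadratic_le (b : OrthonormalBasis (Fin d) ℝ (EuclideanSpace ℝ (Fin d)))
    (c : Fin d → ℝ) (hc0 : ∀ j, 0 ≤ c j) (hc : ∀ j, c j ≤ 1 / 4) :
    ∫⁻ g, ENNReal.ofReal (Real.exp (∑ j, c j * inner ℝ (b j) g ^ 2))
        ∂stdGaussian (EuclideanSpace ℝ (Fin d))
      ≤ ENNReal.ofReal (Real.exp (2 * ∑ j, c j)) := by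
  rw [stdGaussian_eq_map_pi_orthonormalBasis b, lintegral_map (by fun_prop) (by fun_prop)]
  have h : ∀ x : Fin d → ℝ,
      ENNReal.ofReal (Real.exp (∑ j, c j * inner ℝ (b j) (∑ i, x i • b i) ^ 2))
        = ∏ j, ENNReal.ofReal (Real.exp (-(-c j) * (x j - 0) ^ 2)) := fun x => by
    rw [Real.exp_sum, ENNReal.ofReal_prod_of_nonneg fun _ _ => (Real.exp_pos _).le]
    simp [b.orthonormal.inner_right_fintype]
  simp only [h]
  rw [lintegral_prod_pi _ (fun j x => ENNReal.ofReal (Real.exp (-(-c j) * (x - 0) ^ 2)))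
    (by fun_prop), mul_sum, Real.exp_sum,
    ENNReal.ofReal_prod_of_nonneg fun _ _ => (Real.exp_pos _).le]
  refine prod_le_prod' fun j _ => ?_
  have hcj := hc j
  refine (lintegral_exp_neg_mul_sq_gaussianReal_le 1 (by push_cast; linarith) (by simp)).trans ?_
  refine ENNReal.ofReal_le_ofReal (le_trans (le_of_eq ?_)
    (inv_sqrt_one_sub_le_exp (u := 2 * c j) (by linarith [hc0 j]) (by linarith)))
  congr 2
  push_cast; ring

end GaussianMoments

/-! ### Union bound by volume comparison. -/

/-- A union bound over a continuum: if a point of the bad event forces a whole ball of parameters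
`w` on which `h w` is large, then its probability is controlled by the mean of `h` over the
parameters, at the price of a ratio of volumes. -/
lemma measure_mul_le_of_ball {W Ω : Type*} [NormedAddCommGroup W] [NormedSpace ℝ W]
    [FiniteDimensional ℝ W] [MeasurableSpace W] [BorelSpace W] [MeasurableSpace Ω] (P : Measure Ω)
    [SFinite P] (h : W → Ω → ℝ≥0∞) (hm : Measurable (Function.uncurry h)) {T : Set W}
    (hT : MeasurableSet T) {ρ r : ℝ} (hr : 0 < r) (hρ : 0 < ρ) (hTρ : T ⊆ Metric.ball 0 ρ)
    {α β : ℝ≥0∞} (hα : ∀ w ∈ T, ∫⁻ ω, h w ω ∂P ≤ α) {S : Set Ω}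
    (hS : ∀ ω ∈ S, ∃ v, Metric.ball v r ⊆ T ∧ ∀ w ∈ Metric.ball v r, β ≤ h w ω) :
    β * P S ≤ ENNReal.ofReal ((ρ / r) ^ Module.finrank ℝ W) * α := by
  set μ : Measure W := Measure.addHaar
  set κ := μ (Metric.ball 0 1) with hκ
  have hκ0 : κ ≠ 0 := (Metric.measure_ball_pos μ _ one_pos).ne'
  have hκt : κ ≠ ∞ := measure_ball_lt_top.ne
  set D := Module.finrank ℝ W
  have hball : ∀ (x : W) {t : ℝ}, 0 < t → μ (Metric.ball x t) = ENNReal.ofReal (t ^ D) * κ :=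
    fun x t ht => Measure.addHaar_ball_of_pos μ x ht
  -- Markov's inequality is applied to this average, whose mean is bounded by Tonelli. `S` need not
  -- be measurable, since it only has to lie in a superlevel set of `F`.
  set F : Ω → ℝ≥0∞ := fun ω => ∫⁻ w in T, h w ω ∂μ with hF
  have hFm : Measurable F :=
    (hm.comp measurable_swap).lintegral_prod_right' (ν := μ.restrict T)
  have hlow : ∀ ω ∈ S, β * (ENNReal.ofReal (r ^ D) * κ) ≤ F ω := fun ω hω => by
    obtain ⟨v, hv, hβ⟩ := hS ω hω
    calc β * (ENNReal.ofReal (r ^ D) * κ) = ∫⁻ _ in Metric.ball v r, β ∂μ := by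
          rw [setLIntegral_const, hball v hr]
      _ ≤ ∫⁻ w in Metric.ball v r, h w ω ∂μ := setLIntegral_mono' measurableSet_ball hβ
      _ ≤ F ω := lintegral_mono_set hv
  have hup : ∫⁻ ω, F ω ∂P ≤ α * (ENNReal.ofReal (ρ ^ D) * κ) := by
    rw [hF, lintegral_lintegral_swap (f := fun ω w => h w ω) (hm.comp measurable_swap).aemeasurable]
    calc ∫⁻ w in T, ∫⁻ ω, h w ω ∂P ∂μ ≤ ∫⁻ _ in T, α ∂μ := setLIntegral_mono' hT hα
      _ = α * μ T := setLIntegral_const _ _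
      _ ≤ α * (ENNReal.ofReal (ρ ^ D) * κ) := by
          rw [← hball 0 hρ]; gcongr
  have hmarkov : β * (ENNReal.ofReal (r ^ D) * κ) * P S ≤ α * (ENNReal.ofReal (ρ ^ D) * κ) :=
    ((mul_le_mul_right (measure_mono hlow) _).trans
      (mul_meas_ge_le_lintegral hFm _)).trans hup
  have hrD : 0 < r ^ D := pow_pos hr D
  have hc0 : ENNReal.ofReal (r ^ D) * κ ≠ 0 := mul_ne_zero (by simpa using hrD) hκ0
  have hct : ENNReal.ofReal (r ^ D) * κ ≠ ∞ := ENNReal.mul_ne_top ENNReal.ofReal_ne_top hκt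
  rw [← ENNReal.mul_le_mul_iff_right hc0 hct]
  calc ENNReal.ofReal (r ^ D) * κ * (β * P S) = β * (ENNReal.ofReal (r ^ D) * κ) * P S := by ring
    _ ≤ α * (ENNReal.ofReal (ρ ^ D) * κ) := hmarkov
    _ = ENNReal.ofReal (r ^ D) * κ * (ENNReal.ofReal ((ρ / r) ^ D) * α) := by
      have : ρ ^ D = r ^ D * (ρ / r) ^ D := by
        rw [← mul_pow, mul_div_cancel₀ _ hr.ne']
      rw [this, ENNReal.ofReal_mul hrD.le]
      ring

/-! ### Empirical second moment and covariance of standard Gaussian points. -/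

section SmallestSingularValue

variable {n d : ℕ}

/-- The values of the affine functions `x ↦ ⟪x, w⟫ - a` at the points `g i`. -/
noncomputable def affineValues (g : Fin n → EuclideanSpace ℝ (Fin d)) :
    (EuclideanSpace ℝ (Fin d) × ℝ) →ₗ[ℝ] EuclideanSpace ℝ (Fin n) where
  toFun p := WithLp.toLp 2 fun i => inner ℝ (g i) p.1 - p.2
  map_add' p q := by ext i; simp [inner_add_right]; ring
  map_smul' t p := by ext i; simp [inner_smul_right]; ring

lemma norm_affineValues_sq (g : Fin n → EuclideanSpace ℝ (Fin d)) (w : EuclideanSpace ℝ (Fin d))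
    (a : ℝ) : ‖affineValues g (w, a)‖ ^ 2 = ∑ i, (inner ℝ (g i) w - a) ^ 2 := by
  rw [EuclideanSpace.real_norm_sq_eq]; rfl

lemma norm_affineValues_zero_left (g : Fin n → EuclideanSpace ℝ (Fin d)) (a : ℝ) :
    ‖affineValues g (0, a)‖ = √n * |a| := by
  rw [← Real.sqrt_sq (norm_nonneg _), norm_affineValues_sq]
  simp [Real.sqrt_sq_eq_abs]

lemma affineValues_eq_add (g : Fin n → EuclideanSpace ℝ (Fin d)) (w : EuclideanSpace ℝ (Fin d))
    (a : ℝ) : affineValues g (w, a) = affineValues g (w, 0) + affineValues g (0, a) := by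
  rw [← map_add]; simp

lemma measurable_exp_affineValues (s : ℝ) :
    Measurable (Function.uncurry fun (p : EuclideanSpace ℝ (Fin d) × ℝ)
      (g : Fin n → EuclideanSpace ℝ (Fin d)) =>
        ENNReal.ofReal (Real.exp (-s * ‖affineValues g p‖ ^ 2))) := by
  have : (Function.uncurry fun (p : EuclideanSpace ℝ (Fin d) × ℝ)
      (g : Fin n → EuclideanSpace ℝ (Fin d)) =>
        ENNReal.ofReal (Real.exp (-s * ‖affineValues g p‖ ^ 2)))
      = fun q : (EuclideanSpace ℝ (Fin d) × ℝ) × (Fin n → EuclideanSpace ℝ (Fin d)) =>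
        ENNReal.ofReal (Real.exp (-s * ∑ i, (inner ℝ (q.2 i) q.1.1 - q.1.2) ^ 2)) := by
    funext q
    rw [← norm_affineValues_sq]; rfl
  rw [this]
  fun_prop

/-- The empirical second moment matrix of `n` standard Gaussian points is bounded above. -/
lemma measure_large_secondMoment_le (hdn : d ≤ n) :
    gaussianPoints n d {g | ∃ w, 320 * n * ‖w‖ ^ 2 < ‖affineValues g (w, 0)‖ ^ 2}
      ≤ ENNReal.ofReal (Real.exp (-n)) := by
  set S := {g : Fin n → EuclideanSpace ℝ (Fin d) |
    ∃ w, 320 * n * ‖w‖ ^ 2 < ‖affineValues g (w, 0)‖ ^ 2} with hSdef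
  have hkey := measure_mul_le_of_ball (W := EuclideanSpace ℝ (Fin d)) (gaussianPoints n d)
    (fun w g => ENNReal.ofReal (Real.exp (-(-(1 / 16)) * ‖affineValues g (w, 0)‖ ^ 2)))
    (by
      have := (measurable_exp_affineValues (n := n) (d := d) (-(1 / 16))).comp
        (((measurable_fst (α := EuclideanSpace ℝ (Fin d))
          (β := Fin n → EuclideanSpace ℝ (Fin d))).prodMk (measurable_const (a := (0 : ℝ)))).prodMk measurable_snd)
      exact this)
    (T := Metric.ball 0 2) measurableSet_ball (ρ := 2) (r := 1 / 4) (by norm_num) (by norm_num)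
    le_rfl (α := ENNReal.ofReal (Real.exp n)) (β := ENNReal.ofReal (Real.exp (5 * n))) (S := S)
    (by
      intro w hw
      have hw2 : ‖w‖ ^ 2 ≤ 4 := by
        have : ‖w‖ < 2 := by simpa using hw
        nlinarith [norm_nonneg w]
      simp only [norm_affineValues_sq]
      refine (lintegral_exp_sum_sq_le w (by linarith) (by norm_num)).trans ?_
      rw [← ENNReal.ofReal_pow (by positivity)]
      refine ENNReal.ofReal_le_ofReal ?_
      rw [← mul_one (n : ℝ), Real.exp_nat_mul]
      refine pow_le_pow_left₀ (by positivity) ?_ n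
      have h1 := inv_sqrt_one_sub_le_exp (u := ‖w‖ ^ 2 / 8) (by positivity) (by linarith)
      have h2 : 1 + 2 * -(1 / 16) * ‖w‖ ^ 2 = 1 - ‖w‖ ^ 2 / 8 := by ring
      rw [h2]
      exact h1.trans (Real.exp_le_exp.2 (by linarith)))
    (by
      rintro g ⟨w, hw⟩
      set G : EuclideanSpace ℝ (Fin d) →L[ℝ] EuclideanSpace ℝ (Fin n) :=
        LinearMap.toContinuousLinearMap
          (affineValues g ∘ₗ LinearMap.inl ℝ (EuclideanSpace ℝ (Fin d)) ℝ) with hG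
      have hGe : ∀ x, G x = affineValues g (x, 0) := fun x => rfl
      have hN0 := norm_nonneg G
      have hN : 320 * n < ‖G‖ ^ 2 := by
        have h1 := G.le_opNorm w
        rw [hGe] at h1
        have h2 := pow_le_pow_left₀ (norm_nonneg _) h1 2
        rw [mul_pow] at h2
        exact lt_of_mul_lt_mul_right (hw.trans_le h2) (sq_nonneg _)
      have hNpos : 0 < ‖G‖ := by
        rcases hN0.eq_or_lt with h | h
        · rw [← h] at hN
          have : (0 : ℝ) ≤ n := by positivity
          norm_num at hN
          linarith
        · exact h
      -- Within `1/4` of a near-maximiser the image has norm at least `‖G‖/2`, so its square exceeds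
      -- `80 n`; the factor `1/16` turns this into the exponent `5n`.
      obtain ⟨x, hx1, hx2⟩ := G.exists_lt_apply_of_lt_opNorm (r := 3 / 4 * ‖G‖) (by linarith)
      refine ⟨x, fun y hy => ?_, fun y hy => ENNReal.ofReal_le_ofReal (Real.exp_le_exp.2 ?_)⟩
      · have h1 : ‖y - x‖ < 1 / 4 := by simpa [dist_eq_norm] using hy
        have h2 := norm_add_le x (y - x)
        rw [add_sub_cancel] at h2
        simp only [Metric.mem_ball, dist_zero_right]
        linarith
      · have h1 : ‖y - x‖ < 1 / 4 := by simpa [dist_eq_norm] using hy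
        have h2 := G.le_opNorm (y - x)
        have h3 := norm_sub_norm_le (G x) (G x - G y)
        rw [sub_sub_cancel, norm_sub_rev, ← map_sub] at h3
        rw [← hGe]
        have h4 : ‖G‖ / 2 ≤ ‖G y‖ := by nlinarith
        nlinarith)
  have hE : ENNReal.ofReal (((2 : ℝ) / (1 / 4)) ^ Module.finrank ℝ (EuclideanSpace ℝ (Fin d)))
      * ENNReal.ofReal (Real.exp n)
      ≤ ENNReal.ofReal (Real.exp (5 * n)) * ENNReal.ofReal (Real.exp (-n)) := by
    rw [← ENNReal.ofReal_mul (by positivity), ← ENNReal.ofReal_mul (by positivity),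
      finrank_euclideanSpace_fin, ← Real.exp_add]
    refine ENNReal.ofReal_le_ofReal ?_
    have h8 : (2 : ℝ) / (1 / 4) ≤ Real.exp 3 := by
      have h1 : Real.exp 3 = Real.exp 1 ^ 3 := by rw [← Real.exp_nat_mul]; norm_num
      have h2 := pow_le_pow_left₀ (by norm_num) Real.exp_one_gt_d9.le 3
      rw [h1]
      refine le_trans ?_ h2
      norm_num
    calc ((2 : ℝ) / (1 / 4)) ^ d * Real.exp n ≤ Real.exp 3 ^ d * Real.exp n := by gcongr
      _ = Real.exp (d * 3 + n) := by rw [← Real.exp_nat_mul, Real.exp_add]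
      _ ≤ Real.exp (5 * n + -n) := by
        have : (d : ℝ) ≤ n := by exact_mod_cast hdn
        exact Real.exp_le_exp.2 (by linarith)
  have hβ0 : ENNReal.ofReal (Real.exp (5 * n)) ≠ 0 := by simpa using Real.exp_pos _
  exact (ENNReal.mul_le_mul_iff_right hβ0 ENNReal.ofReal_ne_top).1 (hkey.trans hE)

/-- The empirical covariance of `n` standard Gaussian points is bounded below, if the empirical
second moment is bounded above. -/
lemma measure_small_covariance_of_secondMoment_le (hdn : 12 * (d + 1) ≤ n) :
    gaussianPoints n d {g | (∀ w, ‖affineValues g (w, 0)‖ ^ 2 ≤ 320 * n * ‖w‖ ^ 2) ∧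
        ∃ w a, ‖affineValues g (w, a)‖ ^ 2 < n / 40000 * ‖w‖ ^ 2}
      ≤ ENNReal.ofReal (Real.exp (-n)) := by
  set S := {g : Fin n → EuclideanSpace ℝ (Fin d) |
    (∀ w, ‖affineValues g (w, 0)‖ ^ 2 ≤ 320 * n * ‖w‖ ^ 2) ∧
        ∃ w a, ‖affineValues g (w, a)‖ ^ 2 < n / 40000 * ‖w‖ ^ 2} with hSdef
  have hn0 : (0 : ℝ) < n := by
    have : 0 < n := by omega
    exact_mod_cast this
  have hsn : 0 < √(n : ℝ) := Real.sqrt_pos.2 hn0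
  have hsn2 : √(n : ℝ) ^ 2 = n := Real.sq_sqrt hn0.le
  -- The offset is a parameter too, whence dimension `d + 1`. For `‖w‖ ≥ 1/2` the Laplace transform
  -- is at most `5001^(-n/2) ≤ e^(-4n)`; the volume ratio costs at most `e^(12(d+1)) ≤ e^n`.
  have hkey := measure_mul_le_of_ball (W := EuclideanSpace ℝ (Fin d) × ℝ) (gaussianPoints n d)
    (fun p g => ENNReal.ofReal (Real.exp (-10000 * ‖affineValues g p‖ ^ 2)))
    (measurable_exp_affineValues 10000)
    (T := Metric.ball 0 19 ∩ {p | 1 / 2 ≤ ‖p.1‖})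
    (measurableSet_ball.inter (measurableSet_le measurable_const (by fun_prop)))
    (ρ := 19) (r := 1 / 4000) (by norm_num) (by norm_num) Set.inter_subset_left
    (α := ENNReal.ofReal (Real.exp (-(4 * n)))) (β := ENNReal.ofReal (Real.exp (-n))) (S := S)
    (by
      rintro ⟨w, a⟩ ⟨-, hw⟩
      simp only [Set.mem_ofPred_eq] at hw
      have hw2 : 1 / 4 ≤ ‖w‖ ^ 2 := by nlinarith
      simp only [norm_affineValues_sq]
      refine (lintegral_exp_sum_sq_le w (by positivity) (by positivity)).trans ?_
      rw [← ENNReal.ofReal_pow (by positivity)]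
      refine ENNReal.ofReal_le_ofReal ?_
      rw [show (-(4 * n) : ℝ) = n * (-4) by ring, Real.exp_nat_mul]
      refine pow_le_pow_left₀ (by positivity) ?_ n
      rw [Real.exp_neg]
      refine inv_anti₀ (Real.exp_pos _) (Real.le_sqrt_of_sq_le ?_)
      have h1 : Real.exp 4 ^ 2 = Real.exp 1 ^ 8 := by
        rw [← Real.exp_nat_mul, ← Real.exp_nat_mul]; norm_num
      have h2 := pow_le_pow_left₀ (Real.exp_pos 1).le Real.exp_one_lt_d9.le 8
      rw [h1]
      refine h2.trans ?_
      norm_num at *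
      linarith)
    (by
      rintro g ⟨hG, w, a, hwa⟩
      have hwpos : 0 < ‖w‖ := by
        rcases (norm_nonneg w).eq_or_lt with h | h
        · rw [← h] at hwa
          nlinarith [sq_nonneg ‖affineValues g (w, a)‖]
        · exact h
      set v : EuclideanSpace ℝ (Fin d) := ‖w‖⁻¹ • w with hv
      set c : ℝ := ‖w‖⁻¹ * a with hc
      have hvn : ‖v‖ = 1 := by
        rw [hv, norm_smul, norm_inv, norm_norm, inv_mul_cancel₀ hwpos.ne']
      have hop : ∀ x, ‖affineValues g (x, 0)‖ ≤ 179 / 10 * √n * ‖x‖ := fun x => by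
        refine abs_le_of_sq_le_sq' ?_ (by positivity) |>.2
        refine (hG x).trans ?_
        rw [mul_pow, mul_pow, hsn2]
        have := mul_nonneg hn0.le (sq_nonneg ‖x‖)
        nlinarith
      have hsmall : ‖affineValues g (v, c)‖ ≤ √n / 200 := by
        have h1 : affineValues g (v, c) = ‖w‖⁻¹ • affineValues g (w, a) := by
          rw [← map_smul]; rfl
        refine abs_le_of_sq_le_sq' ?_ (by positivity) |>.2
        rw [h1, norm_smul, norm_inv, norm_norm, mul_pow, div_pow, hsn2, inv_pow,
          inv_mul_le_iff₀ (by positivity)]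
        refine hwa.le.trans (le_of_eq ?_)
        ring
      -- The second moment bound (`√320 < 17.9`) confines the offset, so the parameter set is
      -- bounded.
      have hc18 : |c| ≤ 18 := by
        have h1 := norm_sub_le (affineValues g (v, c)) (affineValues g (v, 0))
        rw [← map_sub, Prod.mk_sub_mk, sub_self, sub_zero, norm_affineValues_zero_left] at h1
        have h2 := hop v
        rw [hvn] at h2
        have h3 : √n * |c| ≤ √n * 18 := by nlinarith
        exact le_of_mul_le_mul_left h3 hsn
      refine ⟨(v, c), ?_, ?_⟩
      · rintro ⟨x, t⟩ hx
        rw [mem_ball_iff_norm, Prod.mk_sub_mk, Prod.norm_mk, sup_lt_iff] at hx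
        obtain ⟨hx1, hx2⟩ := hx
        have h1 := norm_add_le v (x - v)
        have h2 := norm_sub_norm_le v (v - x)
        have h3 := abs_add_le c (t - c)
        rw [norm_sub_rev v x, sub_sub_cancel] at h2
        rw [add_sub_cancel] at h1 h3
        rw [Real.norm_eq_abs] at hx2
        refine ⟨?_, ?_⟩
        · rw [mem_ball_zero_iff, Prod.norm_mk, sup_lt_iff, Real.norm_eq_abs]
          constructor <;> linarith
        · simp only [Set.mem_ofPred_eq]
          linarith
      · rintro ⟨x, t⟩ hx
        rw [mem_ball_iff_norm, Prod.mk_sub_mk, Prod.norm_mk, sup_lt_iff, Real.norm_eq_abs] at hx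
        obtain ⟨hx1, hx2⟩ := hx
        refine ENNReal.ofReal_le_ofReal (Real.exp_le_exp.2 ?_)
        have h1 : affineValues g (x, t) = affineValues g (v, c) + affineValues g (x - v, 0)
            + affineValues g (0, t - c) := by
          rw [add_assoc, ← affineValues_eq_add, ← map_add]; simp
        -- The perturbation costs at most `(17.9 + 1)√n / 4000 < √n / 200`.
        have h2 : ‖affineValues g (x, t)‖ ≤ √n / 100 := by
          rw [h1]
          refine norm_add₃_le.trans ?_
          have h3 := hop (x - v)
          rw [norm_affineValues_zero_left]
          have h4 := mul_le_mul_of_nonneg_left hx1.le (show 0 ≤ 179 / 10 * √(n : ℝ) by positivity)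
          have h5 := mul_le_mul_of_nonneg_left hx2.le hsn.le
          linarith
        have h6 := pow_le_pow_left₀ (norm_nonneg _) h2 2
        rw [div_pow, hsn2] at h6
        linarith)
  have hE : ENNReal.ofReal (((19 : ℝ) / (1 / 4000)) ^
        Module.finrank ℝ (EuclideanSpace ℝ (Fin d) × ℝ))
      * ENNReal.ofReal (Real.exp (-(4 * n)))
      ≤ ENNReal.ofReal (Real.exp (-n)) * ENNReal.ofReal (Real.exp (-n)) := by
    rw [← ENNReal.ofReal_mul (by positivity), ← ENNReal.ofReal_mul (by positivity),
      Module.finrank_prod, finrank_euclideanSpace_fin, Module.finrank_self, ← Real.exp_add]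
    refine ENNReal.ofReal_le_ofReal ?_
    have h8 : (19 : ℝ) / (1 / 4000) ≤ Real.exp 12 := by
      have h1 : Real.exp 12 = Real.exp 1 ^ 12 := by rw [← Real.exp_nat_mul]; norm_num
      have h2 := pow_le_pow_left₀ (by norm_num) Real.exp_one_gt_d9.le 12
      rw [h1]
      refine le_trans ?_ h2
      norm_num
    calc ((19 : ℝ) / (1 / 4000)) ^ (d + 1) * Real.exp (-(4 * n))
        ≤ Real.exp 12 ^ (d + 1) * Real.exp (-(4 * n)) := by gcongr
      _ = Real.exp (((d + 1 : ℕ) : ℝ) * 12 + -(4 * n)) := by rw [← Real.exp_nat_mul, Real.exp_add]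
      _ ≤ Real.exp (-n + -n) := by
        have : 12 * ((d + 1 : ℕ) : ℝ) ≤ n := by exact_mod_cast hdn
        exact Real.exp_le_exp.2 (by linarith)
  have hβ0 : ENNReal.ofReal (Real.exp (-n)) ≠ 0 := by simpa using Real.exp_pos _
  exact (ENNReal.mul_le_mul_iff_right hβ0 ENNReal.ofReal_ne_top).1 (hkey.trans hE)

/-- The empirical covariance of `n` standard Gaussian points in dimension at most a constant
multiple of `n` is bounded below. -/
lemma measure_small_covariance_le (hdn : 12 * (d + 1) ≤ n) :
    gaussianPoints n d {g | ∃ w a, ∑ i, (inner ℝ (g i) w - a) ^ 2 < n / 40000 * ‖w‖ ^ 2}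
      ≤ 2 * ENNReal.ofReal (Real.exp (-n)) := by
  rw [two_mul]
  refine le_trans (measure_mono ?_) ((measure_union_le _ _).trans (add_le_add
    (measure_large_secondMoment_le (by omega)) (measure_small_covariance_of_secondMoment_le hdn)))
  rintro g ⟨w, a, h⟩
  by_cases hg : ∃ w, 320 * n * ‖w‖ ^ 2 < ‖affineValues g (w, 0)‖ ^ 2
  · exact Or.inl hg
  · push Not at hg
    exact Or.inr ⟨hg, w, a, by rwa [norm_affineValues_sq]⟩

end SmallestSingularValue

/-! ### Transfer to a general covariance. -/

section Covariance

variable {l : ℕ} {S : Matrix (Fin l) (Fin l) ℝ}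

open scoped MatrixOrder in
/-- The linear map applied to a standard Gaussian in the definition of `multivariateGaussian`. -/
noncomputable abbrev sqrtCLM (S : Matrix (Fin l) (Fin l) ℝ) :
    EuclideanSpace ℝ (Fin l) →L[ℝ] EuclideanSpace ℝ (Fin l) :=
  Matrix.toEuclideanCLM (𝕜 := ℝ) (CFC.sqrt S)

open scoped MatrixOrder in
lemma inner_sqrtCLM_left (x y : EuclideanSpace ℝ (Fin l)) :
    inner ℝ (sqrtCLM S x) y = inner ℝ x (sqrtCLM S y) := by
  have h0 : (CFC.sqrt S).IsHermitian := (Matrix.nonneg_iff_posSemidef.1 (CFC.sqrt_nonneg S)).1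
  have h : IsSelfAdjoint (sqrtCLM S) := h0.isSelfAdjoint.map _
  rw [← ContinuousLinearMap.adjoint_inner_left, h.adjoint_eq]

open scoped MatrixOrder in
lemma norm_sqrtCLM_sq (hS : S.PosSemidef) (x : EuclideanSpace ℝ (Fin l)) :
    ‖sqrtCLM S x‖ ^ 2
      = ∑ j, hS.isHermitian.eigenvalues j * inner ℝ (hS.isHermitian.eigenvectorBasis j) x ^ 2 := by
  set b := hS.isHermitian.eigenvectorBasis
  set A := Matrix.toEuclideanCLM (𝕜 := ℝ) S with hA
  have hAself : IsSelfAdjoint A := hS.isHermitian.isSelfAdjoint.map _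
  have hAb : ∀ j, A (b j) = hS.isHermitian.eigenvalues j • b j := fun j => by
    ext i
    have := congrFun (hS.isHermitian.mulVec_eigenvectorBasis j) i
    simpa [hA] using this
  have h1 : sqrtCLM S (sqrtCLM S x) = A x := by
    rw [← ContinuousLinearMap.comp_apply, ← ContinuousLinearMap.mul_def, ← map_mul,
      CFC.sqrt_mul_sqrt_self _ hS.nonneg]
  rw [← real_inner_self_eq_norm_sq, inner_sqrtCLM_left, h1, ← b.sum_inner_mul_inner x (A x)]
  refine sum_congr rfl fun j _ => ?_
  rw [← ContinuousLinearMap.adjoint_inner_left, hAself.adjoint_eq, hAb, real_inner_smul_left,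
    real_inner_comm]
  ring

lemma lambdaMin_le {A : Matrix (Fin l) (Fin l) ℝ} (hA : A.IsHermitian) (j : Fin l) :
    lambdaMin hA ≤ hA.eigenvalues j :=
  ciInf_le (Set.finite_range _).bddBelow j

lemma le_lambdaMax {A : Matrix (Fin l) (Fin l) ℝ} (hA : A.IsHermitian) (j : Fin l) :
    hA.eigenvalues j ≤ lambdaMax hA :=
  le_ciSup (Set.finite_range _).bddAbove j

lemma lambdaMin_mul_le_norm_sqrtCLM_sq (hS : S.PosSemidef) (x : EuclideanSpace ℝ (Fin l)) :
    lambdaMin hS.isHermitian * ‖x‖ ^ 2 ≤ ‖sqrtCLM S x‖ ^ 2 := by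
  rw [norm_sqrtCLM_sq hS, ← hS.isHermitian.eigenvectorBasis.sum_sq_inner_right x, mul_sum]
  exact sum_le_sum fun j _ => mul_le_mul_of_nonneg_right (lambdaMin_le _ j) (sq_nonneg _)

lemma trace_eq_sum (hS : S.IsHermitian) : S.trace = ∑ j, hS.eigenvalues j := by
  simpa using hS.trace_eq_sum_eigenvalues

/-- The norm of a centred Gaussian vector concentrates on the scale of the trace of its
covariance, with deviations on the scale of the largest eigenvalue. -/
lemma measure_norm_sqrtCLM_sq_gt_le (hS : S.PosSemidef) (hmax : 0 < lambdaMax hS.isHermitian)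
    (t : ℝ) :
    stdGaussian (EuclideanSpace ℝ (Fin l))
        {x | 2 * S.trace + 4 * lambdaMax hS.isHermitian * t < ‖sqrtCLM S x‖ ^ 2}
      ≤ ENNReal.ofReal (Real.exp (-t)) := by
  set Λ := lambdaMax hS.isHermitian
  have hq : ∀ x, ∑ j, hS.isHermitian.eigenvalues j / (4 * Λ)
      * inner ℝ (hS.isHermitian.eigenvectorBasis j) x ^ 2 = ‖sqrtCLM S x‖ ^ 2 / (4 * Λ) := fun x => by
    rw [norm_sqrtCLM_sq hS, sum_div]
    exact sum_congr rfl fun j _ => by ring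
  -- Dividing by `4Λ` brings all weights below `1/4`. The moment is then at most `exp (tr S /
  -- (2Λ))`, which cancels the `2 tr S` in the threshold and leaves `exp (-t)`.
  have hmean := lintegral_exp_quadratic_le hS.isHermitian.eigenvectorBasis
    (fun j => hS.isHermitian.eigenvalues j / (4 * Λ))
    (fun j => div_nonneg (hS.eigenvalues_nonneg j) (by positivity))
    (fun j => by
      rw [div_le_iff₀ (by positivity)]
      linarith [le_lambdaMax hS.isHermitian j])
  simp only [hq, ← sum_div, ← trace_eq_sum] at hmean
  set β := ENNReal.ofReal (Real.exp ((2 * S.trace + 4 * Λ * t) / (4 * Λ)))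
  have hβ0 : β ≠ 0 := by simpa [β] using Real.exp_pos _
  have hmarkov := (mul_meas_ge_le_lintegral (μ := stdGaussian (EuclideanSpace ℝ (Fin l)))
    (f := fun x => ENNReal.ofReal (Real.exp (‖sqrtCLM S x‖ ^ 2 / (4 * Λ)))) (by fun_prop) β).trans
    hmean
  have hsub : {x | 2 * S.trace + 4 * Λ * t < ‖sqrtCLM S x‖ ^ 2}
      ⊆ {x | β ≤ ENNReal.ofReal (Real.exp (‖sqrtCLM S x‖ ^ 2 / (4 * Λ)))} := fun x hx => by
    refine ENNReal.ofReal_le_ofReal (Real.exp_le_exp.2 ?_)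
    exact div_le_div_of_nonneg_right (le_of_lt hx) (by positivity)
  refine (ENNReal.mul_le_mul_iff_right hβ0 ENNReal.ofReal_ne_top).1
    (((mul_le_mul_right (measure_mono hsub) β).trans hmarkov).trans (le_of_eq ?_))
  rw [← ENNReal.ofReal_mul (by positivity), ← Real.exp_add]
  congr 2
  field_simp
  ring

end Covariance

/-! ### Gaussian configurations are well spread. -/

/-- The configurations of `n` points that are spread out in all directions and lie within bounded
distance of each other. -/
def wellSpread (n l : ℕ) (B μ : ℝ) : Set (Fin n → EuclideanSpace ℝ (Fin l)) :=
  {y | (∀ i j, ‖y i - y j‖ ^ 2 ≤ B) ∧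
    ∀ v (c : ℝ), μ * ‖v‖ ^ 2 ≤ ∑ i, (inner ℝ (y i) v - c) ^ 2}

lemma measurableSet_wellSpread (n l : ℕ) (B μ : ℝ) : MeasurableSet (wellSpread n l B μ) := by
  refine IsClosed.measurableSet ?_
  simp only [wellSpread, Set.ofPred_and, Set.ofPred_forall]
  refine (isClosed_iInter fun i => isClosed_iInter fun j => isClosed_le ?_ ?_).inter
    (isClosed_iInter fun v => isClosed_iInter fun c => isClosed_le ?_ ?_)
  all_goals fun_prop

/-- Each point is `m + √S g`. The mean `m` cancels in differences and is absorbed by the free offset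
in the spread condition, so failure forces either one long vector `√S g i` or a nearly flat standard
sample. -/
lemma measure_not_wellSpread_le {n l : ℕ} (hn : 12 * (l + 1) ≤ n)
    {S : Matrix (Fin l) (Fin l) ℝ} (hS : S.PosSemidef) (hmax : 0 < lambdaMax hS.isHermitian)
    (m : EuclideanSpace ℝ (Fin l)) :
    Measure.pi (fun _ : Fin n => multivariateGaussian m S)
        (wellSpread n l (48 * (S.trace + lambdaMax hS.isHermitian * Real.log n))
          (n / 40000 * lambdaMin hS.isHermitian))ᶜ
      ≤ ENNReal.ofReal (5 / (n : ℝ) ^ 2) := by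
  set Λ := lambdaMax hS.isHermitian
  have hn0 : (0 : ℝ) < n := by
    have : 0 < n := by omega
    exact_mod_cast this
  have hlog : 0 ≤ Real.log n := Real.log_natCast_nonneg n
  have htr : 0 ≤ S.trace := hS.trace_nonneg
  have hmap : Measure.pi (fun _ : Fin n => multivariateGaussian m S)
      = (gaussianPoints n l).map fun g i => m + sqrtCLM S (g i) :=
    (Measure.pi_map_pi (f := fun _ x => m + sqrtCLM S x) (fun _ => by fun_prop)).symm
  rw [hmap, Measure.map_apply (by fun_prop) (measurableSet_wellSpread _ _ _ _).compl]
  -- Taking `t = 3 log n` gives each point probability `n⁻³`, so the union costs `n⁻²`. Squared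
  -- distances are at most four times the threshold, hence the constant `48`.
  set far : Fin n → Set (Fin n → EuclideanSpace ℝ (Fin l)) := fun i =>
    (fun g => g i) ⁻¹' {x | 2 * S.trace + 4 * Λ * (3 * Real.log n) < ‖sqrtCLM S x‖ ^ 2}
  set flat : Set (Fin n → EuclideanSpace ℝ (Fin l)) :=
    {g | ∃ w a, ∑ i, (inner ℝ (g i) w - a) ^ 2 < n / 40000 * ‖w‖ ^ 2}
  have hsub : (fun g i => m + sqrtCLM S (g i)) ⁻¹' (wellSpread n l
      (48 * (S.trace + Λ * Real.log n)) (n / 40000 * lambdaMin hS.isHermitian))ᶜ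
      ⊆ (⋃ i, far i) ∪ flat := by
    intro g hg
    by_contra hcon
    simp only [Set.mem_union, Set.mem_iUnion, not_or, not_exists] at hcon
    obtain ⟨hfar, hflat⟩ := hcon
    refine hg ⟨fun i j => ?_, fun v c => ?_⟩
    · have h1 : ‖sqrtCLM S (g i)‖ ^ 2 ≤ _ := not_lt.1 fun h => hfar i h
      have h2 : ‖sqrtCLM S (g j)‖ ^ 2 ≤ _ := not_lt.1 fun h => hfar j h
      rw [add_sub_add_left_eq_sub]
      have h3 := pow_le_pow_left₀ (norm_nonneg _) (norm_sub_le (sqrtCLM S (g i)) (sqrtCLM S (g j))) 2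
      nlinarith [sq_nonneg (‖sqrtCLM S (g i)‖ - ‖sqrtCLM S (g j)‖)]
    · have h1 : n / 40000 * ‖sqrtCLM S v‖ ^ 2
          ≤ ∑ i, (inner ℝ (g i) (sqrtCLM S v) - (c - inner ℝ m v)) ^ 2 := by
        by_contra hlt
        exact hflat ⟨_, _, not_le.1 hlt⟩
      have h2 := mul_le_mul_of_nonneg_left (lambdaMin_mul_le_norm_sqrtCLM_sq hS v)
        (show (0 : ℝ) ≤ n / 40000 by positivity)
      rw [← mul_assoc] at h2
      refine (h2.trans h1).trans (le_of_eq (sum_congr rfl fun i _ => ?_))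
      rw [inner_add_left, inner_sqrtCLM_left]
      ring
  have hfar : ∀ i, gaussianPoints n l (far i) ≤ ENNReal.ofReal (Real.exp (-(3 * Real.log n))) :=
    fun i => by
      have hmeas : MeasurableSet {x | 2 * S.trace + 4 * Λ * (3 * Real.log n) < ‖sqrtCLM S x‖ ^ 2} :=
        measurableSet_lt measurable_const (by fun_prop)
      have := (measurePreserving_eval
        (fun _ : Fin n => stdGaussian (EuclideanSpace ℝ (Fin l))) i).measure_preimage
        hmeas.nullMeasurableSet
      exact this.trans_le (measure_norm_sqrtCLM_sq_gt_le hS hmax _)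
  have hexp3 : Real.exp (-(3 * Real.log n)) = ((n : ℝ) ^ 3)⁻¹ := by
    rw [Real.exp_neg, mul_comm, Real.exp_mul, Real.exp_log hn0]
    norm_cast
  have hexpn : Real.exp (-n) ≤ 2 / (n : ℝ) ^ 2 := by
    have h1 := Real.quadratic_le_exp_of_nonneg hn0.le
    rw [Real.exp_neg, inv_le_comm₀ (Real.exp_pos _) (by positivity), inv_div]
    linarith
  calc gaussianPoints n l _ ≤ gaussianPoints n l ((⋃ i, far i) ∪ flat) := measure_mono hsub
    _ ≤ gaussianPoints n l (⋃ i, far i) + gaussianPoints n l flat := measure_union_le _ _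
    _ ≤ ∑ _i : Fin n, ENNReal.ofReal (((n : ℝ) ^ 3)⁻¹) + 2 * ENNReal.ofReal (2 / (n : ℝ) ^ 2) := by
      refine add_le_add ((measure_iUnion_fintype_le _ _).trans (sum_le_sum fun i _ => ?_))
        ((measure_small_covariance_le hn).trans ?_)
      · rw [← hexp3]; exact hfar i
      · gcongr
    _ = ENNReal.ofReal (5 / (n : ℝ) ^ 2) := by
      rw [sum_const, card_univ, Fintype.card_fin, nsmul_eq_mul, ← ENNReal.ofReal_natCast,
        ← ENNReal.ofReal_mul hn0.le, ← ENNReal.ofReal_ofNat, ← ENNReal.ofReal_mul (by norm_num),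
        ← ENNReal.ofReal_add (by positivity) (by positivity)]
      congr 1
      field_simp
      norm_num

end SNL

/-! ### The main theorem. -/

theorem mainTheorem3 :
    ∃ C : ℝ, 0 < C ∧
      ∀ (n l k : ℕ), 1 ≤ l →
      ∀ (S : Matrix (Fin l) (Fin l) ℝ) (hS : S.PosDef) (m : EuclideanSpace ℝ (Fin l)),
      C * (l : ℝ) ≤ (n : ℝ) →
      C * ((S.trace + SNL.lambdaMax hS.isHermitian * Real.log (n : ℝ)) /
        SNL.lambdaMin hS.isHermitian) ≤ (k : ℝ) →
      ∀ {Ω : Type*} [MeasurableSpace Ω] (P : Measure Ω) [IsProbabilityMeasure P]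
        (z : Fin n → Ω → EuclideanSpace ℝ (Fin l)),
      iIndepFun z P →
      (∀ i, HasLaw (z i) (multivariateGaussian m S) P) →
      ∃ A : Set Ω, MeasurableSet A ∧
        1 - C / (n : ℝ) ^ 2 ≤ P.real A ∧
        ∀ ω ∈ A, SNL.BenignLandscape (SNL.cost (SNL.configuration fun i => z i ω) k) := by
  -- The criterion `4 n B < k μ` needs a constant above `4 * 48 * 40000 = 7.68 * 10 ^ 6`.
  refine ⟨10 ^ 7, by norm_num, ?_⟩
  intro n l k hl S hS m hn hk Ω _ P _ z hind hlaw
  have : Nonempty (Fin l) := ⟨⟨0, hl⟩⟩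
  have hl1 : (1 : ℝ) ≤ l := by exact_mod_cast hl
  have hn0 : (0 : ℝ) < n := by linarith
  have hn12 : 12 * (l + 1) ≤ n := by
    have : (12 * (l + 1) : ℝ) ≤ n := by linarith
    exact_mod_cast this
  have hmin : 0 < SNL.lambdaMin hS.isHermitian := by
    obtain ⟨j, hj⟩ := exists_eq_ciInf_of_finite (f := hS.isHermitian.eigenvalues)
    rw [SNL.lambdaMin, ← hj]
    exact hS.eigenvalues_pos j
  have hmax : 0 < SNL.lambdaMax hS.isHermitian :=
    (hS.eigenvalues_pos ⟨0, hl⟩).trans_le (SNL.le_lambdaMax _ _)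
  have hscale : 0 < S.trace + SNL.lambdaMax hS.isHermitian * Real.log n :=
    add_pos_of_pos_of_nonneg hS.trace_pos (mul_nonneg hmax.le (Real.log_natCast_nonneg n))
  set B := 48 * (S.trace + SNL.lambdaMax hS.isHermitian * Real.log n) with hB
  set μ := n / 40000 * SNL.lambdaMin hS.isHermitian with hμ
  set bad : Set Ω := (fun ω i => z i ω) ⁻¹' (SNL.wellSpread n l B μ)ᶜ with hbad
  have hPbad : P bad ≤ ENNReal.ofReal (5 / (n : ℝ) ^ 2) := by
    have hz : ∀ i, AEMeasurable (z i) P := fun i => (hlaw i).aemeasurable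
    rw [hbad, ← Measure.map_apply_of_aemeasurable (aemeasurable_pi_lambda _ hz)
      (SNL.measurableSet_wellSpread n l B μ).compl, hind.map_fun_eq_pi_map hz]
    simp only [(hlaw _).map_eq]
    exact SNL.measure_not_wellSpread_le hn12 hS.posSemidef hmax m
  -- The `z i` are only almost everywhere measurable, so `bad` is replaced by a measurable hull of
  -- the same probability.
  refine ⟨(toMeasurable P bad)ᶜ, (measurableSet_toMeasurable _ _).compl, ?_, fun ω hω => ?_⟩
  · rw [probReal_compl_eq_one_sub (measurableSet_toMeasurable _ _), measureReal_def,
      measure_toMeasurable]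
    have h1 := ENNReal.toReal_mono ENNReal.ofReal_ne_top hPbad
    rw [ENNReal.toReal_ofReal (by positivity)] at h1
    have h2 : 5 / (n : ℝ) ^ 2 ≤ 10 ^ 7 / (n : ℝ) ^ 2 :=
      div_le_div_of_nonneg_right (by norm_num) (by positivity)
    linarith
  · have hgood : (fun i => z i ω) ∈ SNL.wellSpread n l B μ := by
      by_contra h
      exact hω (subset_toMeasurable P bad h)
    refine SNL.benignLandscape_of_bounds _ (by positivity) (by positivity) hgood.1 hgood.2 ?_
    rw [← mul_div_assoc, div_le_iff₀ hmin] at hk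
    have h1 := mul_le_mul_of_nonneg_left hk hn0.le
    have h2 := mul_pos hn0 hscale
    rw [hB, hμ]
    nlinarith
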